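/- Let $\mathfrak{e} \subset \mathbb{R}$ be a compact set that is not finite. For a polynomial $P$ put $\|P\|_{\mathfrak{e}} = \sup_{z \in \mathfrak{e}} |P(z)|$. For each $m$, let $T_m$ be the Chebyshev polynomial of $\mathfrak{e}$, that is, the monic polynomial of degree $m$ with complex coefficients that minimizes $\|P\|_{\mathfrak{e}}$ over all monic polynomials $P$ of degree $m$, and let $t_m = \|T_m\|_{\mathfrak{e}}$. Let $C(\mathfrak{e})$ be the logarithmic capacity of $\mathfrak{e}$, $$C(\mathfrak{e}) = \exp\Bigl(-\inf_{\mu} \iint \log\frac{1}{|z-w|}\, d\mu(z)\, d\mu(w)\Bigr),$$ where the infimum is over all Borel probability measures $\mu$ on $\mathfrak{e}$ (and $C(\mathfrak{e}) = 0$ if the infimum is $+\infty$). Let $n \ge 1$. If $t_n = 2\,C(\mathfrak{e})^n$, then $t_{nk} = 2\,C(\mathfrak{e})^{nk}$ for every integer $k \ge 1$. -/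

import Mathlib

open MeasureTheory Polynomial
open scoped ENNReal

noncomputable section

/-- The logarithmic energy `I(μ) = ∬ log (1 / |z - w|) dμ(w) dμ(z)`, with values in `[-∞, ∞]`, as the
integral of the positive part minus the integral of the negative part. The kernel is `⊤` on the
diagonal. For a finite measure of bounded support the subtracted integral is finite. -/
def logEnergy (μ : Measure ℂ) : EReal :=
  ((∫⁻ z, ∫⁻ w, (-ENNReal.log (edist z w)).toENNReal ∂μ ∂μ : ℝ≥0∞) : EReal) -
    ((∫⁻ z, ∫⁻ w, (ENNReal.log (edist z w)).toENNReal ∂μ ∂μ : ℝ≥0∞) : EReal)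

/-- The logarithmic capacity `C(e) = exp (- inf I(μ))` of a compact set `e`, the infimum being over
all Borel probability measures `μ` carried by `e`; it is `0` if every such `μ` has infinite energy. -/
def logCapacity (e : Set ℂ) : ℝ :=
  (EReal.exp (-(⨅ μ : {μ : Measure ℂ // IsProbabilityMeasure μ ∧ μ eᶜ = 0},
    logEnergy μ.1))).toReal

/-- The norm `sup_{z ∈ e} |P z|` of a polynomial on `e`. -/
def polySupNorm (e : Set ℂ) (P : ℂ[X]) : ℝ := ⨆ z : e, ‖P.eval (z : ℂ)‖

/-- `T` is monic of degree `n` and has the least norm on `e` among the monic polynomials of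
degree `n`. -/
def IsChebyshevPolynomial (e : Set ℂ) (n : ℕ) (T : ℂ[X]) : Prop :=
  (T.Monic ∧ T.natDegree = n) ∧
    ∀ P : ℂ[X], P.Monic → P.natDegree = n → polySupNorm e T ≤ polySupNorm e P

theorem exists_isChebyshevPolynomial {e : Set ℂ} (he : IsCompact e) (n : ℕ) :
    ∃ T : ℂ[X], IsChebyshevPolynomial e n T := by
  have : CompactSpace e := isCompact_iff_compactSpace.mp he
  let L : ℂ[X] →ₗ[ℂ] C(e, ℂ) := (Polynomial.toContinuousMapOnAlgHom e).toLinearMap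
  have hL : ∀ P : ℂ[X], polySupNorm e P = ‖L P‖ := by
    intro P
    rw [ContinuousMap.norm_eq_iSup_norm]
    rfl
  let V : Submodule ℂ C(e, ℂ) := (Polynomial.degreeLT ℂ n).map L
  have : Module.Finite ℂ (Polynomial.degreeLT ℂ n) :=
    Module.Finite.equiv (Polynomial.degreeLTEquiv ℂ n).symm
  have : FiniteDimensional ℂ V := inferInstance
  have : ProperSpace V := FiniteDimensional.proper ℂ V
  have hlim : Filter.Tendsto (fun v : V => ‖L (X ^ n) + (v : C(e, ℂ))‖)
      (Filter.cocompact V) Filter.atTop := by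
    refine Filter.tendsto_atTop_mono (f := fun v : V => ‖v‖ - ‖L (X ^ n)‖) ?_ ?_
    · intro v
      have h := norm_sub_le (L (X ^ n) + (v : C(e, ℂ))) (L (X ^ n))
      rw [add_sub_cancel_left] at h
      have h' : ‖v‖ = ‖(v : C(e, ℂ))‖ := rfl
      linarith
    · exact Filter.tendsto_atTop_add_const_right _ _ (tendsto_norm_cocompact_atTop (E := V))
  obtain ⟨v, hv⟩ := Continuous.exists_forall_le (by fun_prop) hlim
  obtain ⟨q, hq, hqv⟩ := v.2
  have hq' : q.degree < n := Polynomial.mem_degreeLT.mp hq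
  refine ⟨X ^ n + q, ⟨Polynomial.monic_X_pow_add hq', ?_⟩, ?_⟩
  · exact Polynomial.natDegree_eq_of_degree_eq_some (by
      rw [Polynomial.degree_add_eq_left_of_degree_lt (by rwa [Polynomial.degree_X_pow]),
        Polynomial.degree_X_pow])
  · intro P hP hPn
    have hr : (P - X ^ n).degree < (n : WithBot ℕ) := by
      have hd : P.degree = n := by rw [Polynomial.degree_eq_natDegree hP.ne_zero, hPn]
      have := Polynomial.degree_sub_lt_left (p := P) (q := X ^ n)
        (by rw [hd, Polynomial.degree_X_pow]) hP.ne_zero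
        (by rw [hP.leadingCoeff, (Polynomial.monic_X_pow n).leadingCoeff])
      rwa [hd] at this
    have h := hv ⟨L (P - X ^ n), Submodule.mem_map_of_mem (Polynomial.mem_degreeLT.mpr hr)⟩
    rw [hL, hL, map_add, hqv]
    simpa [map_sub] using h

/-- The Chebyshev polynomial `T_n` of the compact set `e`. -/
def chebyshevPolynomial {e : Set ℂ} (he : IsCompact e) (n : ℕ) : ℂ[X] :=
  (exists_isChebyshevPolynomial he n).choose

/-- `t_n`, the norm of `T_n` on `e`. -/
def chebyshevNorm {e : Set ℂ} (he : IsCompact e) (n : ℕ) : ℝ :=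
  polySupNorm e (chebyshevPolynomial he n)

end

/-! Two inequalities squeeze `t_{nk}`. For the upper bound, take a real monic `R` of degree `n` with
`|R| ≤ t_n` on `e` and compose the degree `k` Chebyshev polynomial of `[-t_n, t_n]` with it: `t_{nk}
≤ 2 (t_n / 2)^k` (`chebyshevNorm_mul_le`), which is `2 C(e)^{nk}` under the hypothesis.

The lower bound `t_n ≥ 2 C(e)^n` is proved without potential theory. The same compositions, times
powers of `X`, give monic polynomials of every degree with explicit bounds on `e`. They bound the
Vandermonde determinant of points of `e`. Averaging its logarithm over independent points bounds `∫∫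
log |z - w|` (`integral_log_dist_le`), and letting the number of points grow removes all lower-order
terms. -/

/-- The Chebyshev polynomial of the interval `[-2s, 2s]`. -/
theorem exists_monic_abs_eval_le {s : ℝ} (hs : 0 < s) (k : ℕ) :
    ∃ Q : ℝ[X], Q.Monic ∧ Q.natDegree = k ∧ ∀ x, |x| ≤ 2 * s → |Q.eval x| ≤ 2 * s ^ k := by
  rcases Nat.eq_zero_or_pos k with rfl | hk
  · exact ⟨1, monic_one, natDegree_one, fun x _ => by norm_num⟩
  · have hc : (2 * s)⁻¹ ≠ 0 := by positivity
    have hd : (C (2 * s)⁻¹ * X : ℝ[X]).natDegree = 1 := natDegree_C_mul_X _ hc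
    -- The leading coefficient of `T_k` is `2 ^ (k - 1)` for `k ≥ 1`, so `2 s ^ k` makes this monic;
    -- at `k = 0` it would give the constant `2`.
    refine ⟨C (2 * s ^ k) * (Chebyshev.T ℝ k).comp (C (2 * s)⁻¹ * X), ?_, ?_, ?_⟩
    · rw [Monic, leadingCoeff_mul, leadingCoeff_C, leadingCoeff_comp (by rw [hd]; exact one_ne_zero),
        Chebyshev.leadingCoeff_T, Chebyshev.natDegree_T, leadingCoeff_mul, leadingCoeff_C,
        leadingCoeff_X]
      obtain ⟨j, rfl⟩ : ∃ j, k = j + 1 := ⟨k - 1, by omega⟩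
      simp only [Int.natAbs_natCast, Nat.add_sub_cancel]
      have h2 : 2 * s ^ (j + 1) * 2 ^ j = (2 * s) ^ (j + 1) := by ring
      rw [mul_one, inv_pow, ← mul_assoc, h2, mul_inv_cancel₀ (by positivity)]
    · rw [natDegree_C_mul (by positivity), natDegree_comp, hd, Chebyshev.natDegree_T]
      simp
    · intro x hx
      have h : |(2 * s)⁻¹ * x| ≤ 1 := by
        rw [abs_mul, abs_of_pos (by positivity), inv_mul_le_iff₀ (by positivity), mul_one]
        exact hx
      have := Chebyshev.abs_eval_T_real_le_one k h
      simp only [eval_mul, eval_C, eval_comp, eval_X]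
      rw [abs_mul, abs_of_pos (by positivity)]
      exact mul_le_of_le_one_right (by positivity) this

/-- The polynomial whose coefficients are the real parts of those of a monic polynomial. -/
theorem Polynomial.Monic.exists_real_abs_eval_le {P : ℂ[X]} (hP : P.Monic) :
    ∃ R : ℝ[X], R.Monic ∧ R.natDegree = P.natDegree ∧
      ∀ x : ℝ, |R.eval x| ≤ ‖P.eval (x : ℂ)‖ := by
  let R : ℝ[X] := ∑ i ∈ Finset.range (P.natDegree + 1), monomial i (P.coeff i).re
  have hc : ∀ i, R.coeff i = (P.coeff i).re := by
    intro i
    simp only [R, finsetSum_coeff, coeff_monomial, Finset.sum_ite_eq', Finset.mem_range]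
    split_ifs with h
    · rfl
    · rw [coeff_eq_zero_of_natDegree_lt (by omega), Complex.zero_re]
  have hle : R.natDegree ≤ P.natDegree := by
    rw [natDegree_le_iff_coeff_eq_zero]
    intro i hi
    rw [hc, coeff_eq_zero_of_natDegree_lt hi, Complex.zero_re]
  have hlead : R.coeff P.natDegree = 1 := by rw [hc, hP.coeff_natDegree, Complex.one_re]
  have hdeg : R.natDegree = P.natDegree :=
    le_antisymm hle (le_natDegree_of_ne_zero (by rw [hlead]; exact one_ne_zero))
  refine ⟨R, by rw [Monic, Polynomial.leadingCoeff, hdeg, hlead], hdeg, fun x => ?_⟩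
  have : R.eval x = (P.eval (x : ℂ)).re := by
    rw [eval_eq_sum_range, eval_eq_sum_range, hdeg, Complex.re_sum]
    refine Finset.sum_congr rfl fun i _ => ?_
    rw [hc, ← Complex.ofReal_pow, Complex.re_mul_ofReal]
  rw [this]
  exact Complex.abs_re_le_norm _

theorem Polynomial.norm_eval_map_ofReal (Q : ℝ[X]) (x : ℝ) :
    ‖(Q.map (algebraMap ℝ ℂ)).eval (x : ℂ)‖ = |Q.eval x| := by
  rw [← Complex.coe_algebraMap, eval_map, eval₂_at_apply, Complex.coe_algebraMap,
    Complex.norm_real, Real.norm_eq_abs]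

/-! ### Vandermonde determinants -/

/-- The crude Leibniz bound suffices: `log n!` is `o(n ^ 2)`, negligible against the number of pairs
of points. -/
theorem Matrix.norm_det_le_factorial_mul_prod {n : ℕ} (A : Matrix (Fin n) (Fin n) ℂ)
    (b : Fin n → ℝ) (h : ∀ i j, ‖A i j‖ ≤ b j) : ‖A.det‖ ≤ n.factorial * ∏ j, b j := by
  rw [Matrix.det_apply]
  refine (norm_sum_le _ _).trans ?_
  refine (Finset.sum_le_card_nsmul _ _ (∏ j, b j) fun σ _ => ?_).trans_eq ?_
  · rw [Units.smul_def, zsmul_eq_mul, norm_mul, norm_prod]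
    have : ‖((Equiv.Perm.sign σ : ℤ) : ℂ)‖ = 1 := by
      rcases Int.units_eq_one_or (Equiv.Perm.sign σ) with h | h <;> simp [h]
    rw [this, one_mul]
    exact Finset.prod_le_prod (fun _ _ => norm_nonneg _) fun i _ => h _ _
  · rw [Finset.card_univ, Fintype.card_perm, Fintype.card_fin, nsmul_eq_mul]

/-- Replacing the monomials by monic polynomials of the same degrees is a unitriangular column
operation, so it preserves the Vandermonde determinant. -/
theorem sum_log_dist_le {n : ℕ} {z : Fin n → ℂ} (hz : Function.Injective z) {p : Fin n → ℂ[X]}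
    (hp : ∀ i, (p i).Monic) (hdeg : ∀ i, (p i).natDegree = i) {b : Fin n → ℝ}
    (hb : ∀ i, 0 < b i) (h : ∀ i j, ‖(p j).eval (z i)‖ ≤ b j) :
    ∑ i, ∑ j ∈ Finset.Ioi i, Real.log (dist (z i) (z j)) ≤
      Real.log n.factorial + ∑ j, Real.log (b j) := by
  have hne : ∀ i, ∀ j ∈ Finset.Ioi i, dist (z i) (z j) ≠ 0 := fun i j hj =>
    dist_ne_zero.mpr (hz.ne (Finset.mem_Ioi.mp hj).ne)
  have hV : ∏ i, ∏ j ∈ Finset.Ioi i, dist (z i) (z j) ≤ n.factorial * ∏ j, b j := by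
    have := Matrix.norm_det_le_factorial_mul_prod (Matrix.of fun i j => (p j).eval (z i)) b h
    rw [← Matrix.det_eval_matrixOfPolynomials_eq_det_vandermonde z p hdeg hp,
      Matrix.det_vandermonde, norm_prod] at this
    refine le_trans (le_of_eq ?_) this
    refine Finset.prod_congr rfl fun i _ => ?_
    rw [norm_prod]
    exact Finset.prod_congr rfl fun j _ => by rw [dist_comm, dist_eq_norm]
  have hb' : ∏ j, b j ≠ 0 := (Finset.prod_pos fun j _ => hb j).ne'
  calc _ = Real.log (∏ i, ∏ j ∈ Finset.Ioi i, dist (z i) (z j)) := by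
        rw [Real.log_prod fun i _ => Finset.prod_ne_zero_iff.mpr (hne i)]
        exact Finset.sum_congr rfl fun i _ => (Real.log_prod (hne i)).symm
    _ ≤ Real.log (n.factorial * ∏ j, b j) := Real.log_le_log
        (Finset.prod_pos fun i _ => Finset.prod_pos fun j hj => dist_nonneg.lt_of_ne' (hne i j hj))
        hV
    _ = _ := by
        rw [Real.log_mul (by positivity) hb', Real.log_prod fun j _ => (hb j).ne']

/-! ### Logarithmic energy as a real integral -/

theorem ENNReal.neg_log_edist_toENNReal {z w : ℂ} (h : z ≠ w) :
    (-ENNReal.log (edist z w)).toENNReal = ENNReal.ofReal (-Real.log (dist z w)) := by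
  rw [edist_dist, ENNReal.log_ofReal_of_pos (dist_pos.mpr h), ← EReal.coe_neg,
    EReal.real_coe_toENNReal]

theorem ENNReal.log_edist_toENNReal (z w : ℂ) :
    (ENNReal.log (edist z w)).toENNReal = ENNReal.ofReal (Real.log (dist z w)) := by
  rcases eq_or_ne z w with rfl | h
  · simp
  · rw [edist_dist, ENNReal.log_ofReal_of_pos (dist_pos.mpr h), EReal.real_coe_toENNReal]

/-- Finite energy forces the diagonal to be null, since the kernel is `⊤` there. This must be
recorded separately because `Real.log 0 = 0` hides it from the real integral. -/
theorem logEnergy_eq_top_or (μ : Measure ℂ) [IsProbabilityMeasure μ] {e : Set ℂ}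
    (he : Bornology.IsBounded e) (hμ : μ eᶜ = 0) :
    logEnergy μ = ⊤ ∨ ((∀ᵐ p ∂μ.prod μ, p.1 ≠ p.2) ∧
      Integrable (fun p : ℂ × ℂ => Real.log (dist p.1 p.2)) (μ.prod μ) ∧
      logEnergy μ = ((-∫ p, Real.log (dist p.1 p.2) ∂μ.prod μ : ℝ) : EReal)) := by
  let F : ℂ × ℂ → ℝ≥0∞ := fun p => (-ENNReal.log (edist p.1 p.2)).toENNReal
  let G : ℂ × ℂ → ℝ≥0∞ := fun p => (ENNReal.log (edist p.1 p.2)).toENNReal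
  have hF : Measurable F := (measurable_edist.ennreal_log.neg).ereal_toENNReal
  have hG : Measurable G := measurable_edist.ennreal_log.ereal_toENNReal
  have hE : logEnergy μ = ((∫⁻ p, F p ∂μ.prod μ : ℝ≥0∞) : EReal) -
      ((∫⁻ p, G p ∂μ.prod μ : ℝ≥0∞) : EReal) := by
    rw [lintegral_prod _ hF.aemeasurable, lintegral_prod _ hG.aemeasurable]
    rfl
  have hmem : ∀ᵐ z ∂μ, z ∈ e := hμ
  have hGtop : ∫⁻ p, G p ∂μ.prod μ ≠ ⊤ := by
    obtain ⟨M, hM⟩ := Metric.isBounded_iff.mp he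
    have hle : ∀ᵐ p ∂μ.prod μ, G p ≤ ENNReal.ofReal M := by
      filter_upwards [Measure.quasiMeasurePreserving_fst.ae hmem,
        Measure.quasiMeasurePreserving_snd.ae hmem] with p h1 h2
      rw [show G p = _ from ENNReal.log_edist_toENNReal p.1 p.2]
      exact ENNReal.ofReal_le_ofReal ((Real.log_le_self dist_nonneg).trans (hM h1 h2))
    refine ((lintegral_mono_ae hle).trans_lt ?_).ne
    simp
  by_cases hFtop : ∫⁻ p, F p ∂μ.prod μ = ⊤
  · left
    rw [hE, hFtop]
    lift ∫⁻ p, G p ∂μ.prod μ to NNReal using hGtop with g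
    exact EReal.top_sub_coe g
  · right
    have hdiag : ∀ᵐ p ∂μ.prod μ, p.1 ≠ p.2 := by
      filter_upwards [ae_lt_top hF hFtop] with p hp h
      simp [F, h] at hp
    have hm : Measurable fun p : ℂ × ℂ => Real.log (dist p.1 p.2) := measurable_dist.log
    have hFe : ∫⁻ p, F p ∂μ.prod μ =
        ∫⁻ p, ENNReal.ofReal (-Real.log (dist p.1 p.2)) ∂μ.prod μ :=
      lintegral_congr_ae (by
        filter_upwards [hdiag] with p hp using ENNReal.neg_log_edist_toENNReal hp)
    have hGe : ∫⁻ p, G p ∂μ.prod μ = ∫⁻ p, ENNReal.ofReal (Real.log (dist p.1 p.2)) ∂μ.prod μ :=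
      lintegral_congr fun p => ENNReal.log_edist_toENNReal p.1 p.2
    have hint : Integrable (fun p : ℂ × ℂ => Real.log (dist p.1 p.2)) (μ.prod μ) := by
      refine ⟨hm.aestronglyMeasurable, ?_⟩
      rw [hasFiniteIntegral_iff_norm]
      have hn : ∀ x : ℝ, ENNReal.ofReal ‖x‖ = ENNReal.ofReal x + ENNReal.ofReal (-x) := by
        intro x
        rcases le_total 0 x with h | h
        · rw [Real.norm_of_nonneg h, ENNReal.ofReal_of_nonpos (neg_nonpos.mpr h), add_zero]
        · rw [Real.norm_of_nonpos h, ENNReal.ofReal_of_nonpos h, zero_add]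
      simp_rw [hn]
      rw [lintegral_add_left hm.ennreal_ofReal, ← hFe, ← hGe]
      exact ENNReal.add_lt_top.mpr ⟨hGtop.lt_top, Ne.lt_top hFtop⟩
    refine ⟨hdiag, hint, ?_⟩
    rw [integral_eq_lintegral_pos_part_sub_lintegral_neg_part hint, ← hFe, ← hGe, hE, neg_sub,
      EReal.coe_sub, EReal.coe_ennreal_toReal hFtop, EReal.coe_ennreal_toReal hGtop]

/-! ### Averaging over independent points -/

theorem MeasureTheory.measurePreserving_eval_prod {ι α : Type*} [Fintype ι] [MeasurableSpace α]
    (μ : Measure α) [IsProbabilityMeasure μ] {i j : ι} (hij : i ≠ j) :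
    MeasurePreserving (fun z : ι → α => (z i, z j)) (Measure.pi fun _ => μ) (μ.prod μ) := by
  refine ⟨by fun_prop, ?_⟩
  have hind := ProbabilityTheory.iIndepFun_pi (μ := fun _ : ι => μ) (X := fun _ => id)
    fun _ => aemeasurable_id
  have h := (ProbabilityTheory.indepFun_iff_map_prod_eq_prod_map_map
    (measurable_pi_apply i).aemeasurable (measurable_pi_apply j).aemeasurable).mp (hind.indepFun hij)
  rw [h, (measurePreserving_eval (fun _ : ι => μ) i).map_eq,
    (measurePreserving_eval (fun _ : ι => μ) j).map_eq]

theorem Fin.sum_sum_Ioi_const (n : ℕ) (c : ℝ) :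
    ∑ i : Fin n, ∑ _j ∈ Finset.Ioi i, c = n * (n - 1) / 2 * c := by
  have h : ∑ i : Fin n, (Finset.Ioi i).card = ∑ i ∈ Finset.range n, i := by
    simp only [Fin.card_Ioi]
    rw [Fin.sum_univ_eq_sum_range (fun i => n - 1 - i), Finset.sum_range_reflect (fun i => i)]
  have h2 : ((∑ i ∈ Finset.range n, i : ℕ) : ℝ) * 2 = n * (n - 1) := by
    rcases n with _ | n
    · simp
    · rw [Nat.cast_succ, add_sub_cancel_right]
      exact_mod_cast Finset.sum_range_id_mul_two (n + 1)
  simp only [Finset.sum_const, nsmul_eq_mul]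
  rw [← Finset.sum_mul, ← Nat.cast_sum, h, ← h2]
  ring

/-- The Fekete-type bound: the mean of `log |z - w|` is controlled by any sequence of monic
polynomials with known bounds on the support. -/
theorem integral_log_dist_le {μ : Measure ℂ} [IsProbabilityMeasure μ] {e : Set ℂ}
    (hμ : μ eᶜ = 0) (hdiag : ∀ᵐ p ∂μ.prod μ, p.1 ≠ p.2)
    (hint : Integrable (fun p : ℂ × ℂ => Real.log (dist p.1 p.2)) (μ.prod μ))
    {p : ℕ → ℂ[X]} (hp : ∀ i, (p i).Monic) (hdeg : ∀ i, (p i).natDegree = i) {b : ℕ → ℝ}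
    (hb : ∀ i, 0 < b i) (h : ∀ z ∈ e, ∀ i, ‖(p i).eval z‖ ≤ b i) (n : ℕ) :
    n * (n - 1) / 2 * ∫ p, Real.log (dist p.1 p.2) ∂μ.prod μ ≤
      Real.log n.factorial + ∑ j ∈ Finset.range n, Real.log (b j) := by
  let ν : Measure (Fin n → ℂ) := Measure.pi fun _ => μ
  have hpres : ∀ i, ∀ j ∈ Finset.Ioi i,
      MeasurePreserving (fun z : Fin n → ℂ => (z i, z j)) ν (μ.prod μ) := fun i j hj =>
    measurePreserving_eval_prod μ (Finset.mem_Ioi.mp hj).ne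
  have hcomp : ∀ i, ∀ j ∈ Finset.Ioi i,
      Integrable (fun z : Fin n → ℂ => Real.log (dist (z i) (z j))) ν := fun i j hj =>
    (hpres i j hj).integrable_comp_of_integrable hint
  have hval : ∀ i, ∀ j ∈ Finset.Ioi i, ∫ z, Real.log (dist (z i) (z j)) ∂ν =
      ∫ p, Real.log (dist p.1 p.2) ∂μ.prod μ := by
    intro i j hj
    rw [← (hpres i j hj).map_eq, integral_map (hpres i j hj).measurable.aemeasurable]
    rw [(hpres i j hj).map_eq]
    exact hint.aestronglyMeasurable
  have hinj : ∀ᵐ z ∂ν, Function.Injective z := by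
    have : ∀ᵐ z ∂ν, ∀ i j : Fin n, i ≠ j → z i ≠ z j := by
      simp only [ae_all_iff]
      exact fun i j hij =>
        (measurePreserving_eval_prod μ hij).quasiMeasurePreserving.ae hdiag
    filter_upwards [this] with z hz i j hij
    by_contra hne
    exact hz i j hne hij
  have hmem : ∀ᵐ z ∂ν, ∀ i, z i ∈ e := by
    rw [ae_all_iff]
    exact fun i => (measurePreserving_eval (fun _ => μ) i).quasiMeasurePreserving.ae hμ
  calc _ = ∫ z, ∑ i, ∑ j ∈ Finset.Ioi i, Real.log (dist (z i) (z j)) ∂ν := by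
        rw [integral_finsetSum _ fun i _ => integrable_finsetSum _ (hcomp i),
          ← Fin.sum_sum_Ioi_const]
        refine Finset.sum_congr rfl fun i _ => ?_
        rw [integral_finsetSum _ (hcomp i)]
        exact Finset.sum_congr rfl fun j hj => (hval i j hj).symm
    _ ≤ ∫ _z, Real.log n.factorial + ∑ j ∈ Finset.range n, Real.log (b j) ∂ν := by
        refine integral_mono_ae
          (integrable_finsetSum _ fun i _ => integrable_finsetSum _ (hcomp i))
          (integrable_const _) ?_
        filter_upwards [hinj, hmem] with z hz hze
        rw [← Fin.sum_univ_eq_sum_range fun j => Real.log (b j)]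
        exact sum_log_dist_le (p := fun i => p i) (b := fun i => b i) hz (fun i => hp i)
          (fun i => hdeg i) (fun i => hb i) fun i j => h _ (hze i) j
    _ = _ := by simp

/-! ### The capacity bound from one polynomial -/

theorem sum_range_mul_div (m K : ℕ) (hm : 1 ≤ m) (x : ℝ) :
    ∑ j ∈ Finset.range (m * K), ((j / m : ℕ) : ℝ) * x = m * (K * (K - 1) / 2) * x := by
  induction K with
  | zero => simp
  | succ K ih =>
    rw [Nat.mul_succ, Finset.sum_range_add, ih]
    have : ∀ i ∈ Finset.range m, (((m * K + i) / m : ℕ) : ℝ) * x = K * x := by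
      intro i hi
      rw [Nat.mul_add_div hm, Nat.div_eq_of_lt (Finset.mem_range.mp hi), add_zero]
    rw [Finset.sum_congr rfl this, Finset.sum_const, Finset.card_range, nsmul_eq_mul]
    push_cast
    ring

/-- A measure on a real set where a monic polynomial of degree `m` is bounded by `2s` has
logarithmic energy at least `-(log s) / m`. -/
theorem mul_integral_log_dist_le_log {μ : Measure ℂ} [IsProbabilityMeasure μ] {e : Set ℂ}
    (he : Bornology.IsBounded e) (hμ : μ eᶜ = 0) (hdiag : ∀ᵐ p ∂μ.prod μ, p.1 ≠ p.2)
    (hint : Integrable (fun p : ℂ × ℂ => Real.log (dist p.1 p.2)) (μ.prod μ))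
    (hreal : ∀ z ∈ e, z.im = 0) {R : ℝ[X]} (hR : R.Monic) (hm : 1 ≤ R.natDegree) {s : ℝ}
    (hs : 0 < s) (hRs : ∀ x : ℝ, (x : ℂ) ∈ e → |R.eval x| ≤ 2 * s) :
    R.natDegree * ∫ p, Real.log (dist p.1 p.2) ∂μ.prod μ ≤ Real.log s := by
  set m := R.natDegree with hmdef
  set c := ∫ p, Real.log (dist p.1 p.2) ∂μ.prod μ
  obtain ⟨M, hM1, hM⟩ : ∃ M : ℝ, 1 ≤ M ∧ ∀ z ∈ e, ‖z‖ ≤ M := by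
    obtain ⟨M, hM⟩ := he.exists_norm_le
    exact ⟨max 1 M, le_max_left _ _, fun z hz => (hM z hz).trans (le_max_right _ _)⟩
  choose Q hQ hQd hQs using exists_monic_abs_eval_le hs
  -- Writing `i = m (i / m) + i % m`, the composition carries the sharp bound, while the remaining
  -- power of `X` costs at most the fixed factor `M ^ m`, as `M ≥ 1`.
  let q : ℕ → ℝ[X] := fun i => (Q (i / m)).comp R * X ^ (i % m)
  have hqm : ∀ i, (q i).Monic := fun i => ((hQ _).comp hR (by omega)).mul (monic_X_pow _)
  have hqd : ∀ i, (q i).natDegree = i := by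
    intro i
    rw [Monic.natDegree_mul ((hQ _).comp hR (by omega)) (monic_X_pow _), natDegree_comp, hQd,
      natDegree_X_pow, ← hmdef]
    exact Nat.div_add_mod' i m
  let b : ℕ → ℝ := fun i => 2 * s ^ (i / m) * M ^ m
  have hM0 : 0 < M := one_pos.trans_le hM1
  have hb : ∀ i, 0 < b i := fun i => by positivity
  have hqb : ∀ z ∈ e, ∀ i, ‖((q i).map (algebraMap ℝ ℂ)).eval z‖ ≤ b i := by
    intro z hz i
    obtain ⟨x, rfl⟩ : ∃ x : ℝ, (x : ℂ) = z := ⟨z.re, Complex.ext rfl (by simp [hreal z hz])⟩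
    have hx : |x| ≤ M := by simpa using hM _ hz
    rw [norm_eval_map_ofReal]
    simp only [q, eval_mul, eval_comp, eval_pow, eval_X, abs_mul, abs_pow]
    refine mul_le_mul (hQs _ _ (hRs x hz)) ?_ (by positivity) (by positivity)
    exact (pow_le_pow_left₀ (abs_nonneg x) hx _).trans
      (pow_le_pow_right₀ hM1 (Nat.mod_lt _ hm).le)
  have key : ∀ K : ℕ, 1 ≤ K → (m * K * (m * K - 1) / 2 * c : ℝ) ≤
      m * K * Real.log (m * K) + (m * K * Real.log (2 * M ^ m) +
        m * (K * (K - 1) / 2) * Real.log s) := by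
    intro K hK
    have h := integral_log_dist_le hμ hdiag hint (p := fun i => (q i).map (algebraMap ℝ ℂ))
      (fun i => (hqm i).map _) (fun i => by rw [natDegree_map, hqd]) hb hqb (m * K)
    have hfac : Real.log (m * K).factorial ≤ m * K * Real.log (m * K) := by
      have : Real.log (m * K).factorial ≤ Real.log (((m * K : ℕ) : ℝ) ^ (m * K)) :=
        Real.log_le_log (by positivity) (by exact_mod_cast Nat.factorial_le_pow (m * K))
      rw [Real.log_pow] at this
      exact_mod_cast this
    have hsum : ∑ j ∈ Finset.range (m * K), Real.log (b j) =
        m * K * Real.log (2 * M ^ m) + m * (K * (K - 1) / 2) * Real.log s := by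
      rw [← sum_range_mul_div m K hm, ← Nat.cast_mul, ← nsmul_eq_mul]
      nth_rewrite 2 [← Finset.card_range (m * K)]
      rw [← Finset.sum_const, ← Finset.sum_add_distrib]
      refine Finset.sum_congr rfl fun j _ => ?_
      rw [← Real.log_pow, ← Real.log_mul (by positivity) (by positivity)]
      congr 1
      ring
    rw [hsum] at h
    push_cast at h
    linarith
  have hm0 : (0 : ℝ) < m := by exact_mod_cast hm
  have hinv : Filter.Tendsto (fun K : ℕ => ((K : ℝ))⁻¹) Filter.atTop (nhds 0) :=
    tendsto_inv_atTop_nhds_zero_nat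
  have hlog : Filter.Tendsto (fun K : ℕ => Real.log (m * K) / (m * K)) Filter.atTop (nhds 0) := by
    have := Real.isLittleO_log_id_atTop.tendsto_div_nhds_zero
    exact this.comp (tendsto_natCast_atTop_atTop.const_mul_atTop hm0)
  have hl : Filter.Tendsto (fun K : ℕ => ((m : ℝ) - (K : ℝ)⁻¹) * c) Filter.atTop
      (nhds ((m - 0) * c)) := (hinv.const_sub _).mul_const _
  have hr : Filter.Tendsto (fun K : ℕ => 2 * m * (Real.log (m * K) / (m * K)) +
      (2 * Real.log (2 * M ^ m) * (K : ℝ)⁻¹ + (1 - (K : ℝ)⁻¹) * Real.log s)) Filter.atTop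
      (nhds (2 * m * 0 + (2 * Real.log (2 * M ^ m) * 0 + (1 - 0) * Real.log s))) :=
    (hlog.const_mul _).add ((hinv.const_mul _).add ((hinv.const_sub _).mul_const _))
  have := le_of_tendsto_of_tendsto hl hr (by
    filter_upwards [Filter.eventually_ge_atTop 1] with K hK
    have hK0 : (0 : ℝ) < K := by exact_mod_cast hK
    -- This normalization turns the coefficient of `c` into `m - 1 / K` and that of `log s` into `1
    -- - 1 / K`; the other terms vanish in the limit.
    have h := mul_le_mul_of_nonneg_left (key K hK)
      (by positivity : (0 : ℝ) ≤ 2 / (m * K ^ 2))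
    refine le_trans (le_of_eq ?_) (h.trans (le_of_eq ?_))
    · field_simp
    · field_simp)
  simpa using this

theorem logCapacity_pow_le {e : Set ℂ} (he : Bornology.IsBounded e)
    (hreal : ∀ z ∈ e, z.im = 0) {R : ℝ[X]} (hR : R.Monic) (hm : 1 ≤ R.natDegree) {s : ℝ}
    (hs : 0 < s) (hRs : ∀ x : ℝ, (x : ℂ) ∈ e → |R.eval x| ≤ 2 * s) :
    logCapacity e ^ R.natDegree ≤ s := by
  have hm0 : (0 : ℝ) < R.natDegree := by exact_mod_cast hm
  set L : ℝ := Real.log s / R.natDegree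
  have hI : ((-L : ℝ) : EReal) ≤ ⨅ μ : {μ : Measure ℂ // IsProbabilityMeasure μ ∧ μ eᶜ = 0},
      logEnergy μ.1 := by
    refine le_iInf fun ⟨μ, hprob, hμ⟩ => ?_
    rcases logEnergy_eq_top_or μ he hμ with h | ⟨hdiag, hint, h⟩
    · rw [h]
      exact le_top
    · rw [h, EReal.coe_le_coe_iff, neg_le_neg_iff, le_div_iff₀' hm0]
      exact mul_integral_log_dist_le_log he hμ hdiag hint hreal hR hm hs hRs
  have hC : logCapacity e ≤ Real.exp L := by
    have h : EReal.exp (-(⨅ μ : {μ : Measure ℂ // IsProbabilityMeasure μ ∧ μ eᶜ = 0},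
        logEnergy μ.1)) ≤ ENNReal.ofReal (Real.exp L) := by
      rw [← EReal.exp_coe, EReal.exp_le_exp_iff, EReal.neg_le]
      exact_mod_cast hI
    exact ENNReal.toReal_le_of_le_ofReal (Real.exp_pos _).le h
  calc logCapacity e ^ R.natDegree ≤ Real.exp L ^ R.natDegree :=
        pow_le_pow_left₀ ENNReal.toReal_nonneg hC _
    _ = s := by rw [← Real.exp_nat_mul, mul_div_cancel₀ _ hm0.ne', Real.exp_log hs]

/-! ### Bounds for Chebyshev norms -/

theorem norm_eval_le_polySupNorm {e : Set ℂ} (he : IsCompact e) (P : ℂ[X]) {z : ℂ} (hz : z ∈ e) :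
    ‖P.eval z‖ ≤ polySupNorm e P := by
  have hbdd := he.bddAbove_image (f := fun z => ‖P.eval z‖) (by fun_prop)
  rw [Set.image_eq_range] at hbdd
  exact le_ciSup hbdd ⟨z, hz⟩

theorem polySupNorm_pos {e : Set ℂ} (he : IsCompact e) (hinf : e.Infinite) {P : ℂ[X]}
    (hP : P ≠ 0) : 0 < polySupNorm e P := by
  obtain ⟨z, hz, hroot⟩ := hinf.exists_notMem_finset P.roots.toFinset
  refine lt_of_lt_of_le (norm_pos_iff.mpr fun h => hroot ?_) (norm_eval_le_polySupNorm he P hz)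
  rw [Multiset.mem_toFinset, mem_roots hP]
  exact h

theorem chebyshevPolynomial_spec {e : Set ℂ} (he : IsCompact e) (n : ℕ) :
    IsChebyshevPolynomial e n (chebyshevPolynomial he n) :=
  (exists_isChebyshevPolynomial he n).choose_spec

/-- For a set on the real line the Chebyshev norms are attained by real polynomials. -/
theorem exists_real_abs_eval_le_chebyshevNorm {e : Set ℂ} (he : IsCompact e) (n : ℕ) :
    ∃ R : ℝ[X], R.Monic ∧ R.natDegree = n ∧
      ∀ x : ℝ, (x : ℂ) ∈ e → |R.eval x| ≤ chebyshevNorm he n := by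
  obtain ⟨⟨hT, hTn⟩, -⟩ := chebyshevPolynomial_spec he n
  obtain ⟨R, hR, hRn, hle⟩ := hT.exists_real_abs_eval_le
  exact ⟨R, hR, hRn.trans hTn, fun x hx => (hle x).trans (norm_eval_le_polySupNorm he _ hx)⟩

theorem chebyshevNorm_pos {e : Set ℂ} (he : IsCompact e) (hinf : e.Infinite) (n : ℕ) :
    0 < chebyshevNorm he n :=
  polySupNorm_pos he hinf (chebyshevPolynomial_spec he n).1.1.ne_zero

/-- The capacity bound with `s = t_n / 2`, positive because a nonzero polynomial cannot vanish on an
infinite set. -/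
theorem two_mul_logCapacity_pow_le_chebyshevNorm {e : Set ℂ} (he : IsCompact e)
    (hinf : e.Infinite) (hreal : ∀ z ∈ e, z.im = 0) {n : ℕ} (hn : 1 ≤ n) :
    2 * logCapacity e ^ n ≤ chebyshevNorm he n := by
  obtain ⟨R, hR, rfl, hle⟩ := exists_real_abs_eval_le_chebyshevNorm he n
  have := logCapacity_pow_le he.isBounded hreal hR hn
    (half_pos (chebyshevNorm_pos he hinf R.natDegree)) fun x hx => (hle x hx).trans_eq (by ring)
  linarith

theorem chebyshevNorm_mul_le {e : Set ℂ} (he : IsCompact e) (hinf : e.Infinite)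
    (hreal : ∀ z ∈ e, z.im = 0) {n : ℕ} (hn : 1 ≤ n) (k : ℕ) :
    chebyshevNorm he (n * k) ≤ 2 * (chebyshevNorm he n / 2) ^ k := by
  obtain ⟨R, hR, hRn, hle⟩ := exists_real_abs_eval_le_chebyshevNorm he n
  obtain ⟨Q, hQ, hQk, hQle⟩ :=
    exists_monic_abs_eval_le (half_pos (chebyshevNorm_pos he hinf n)) k
  have hmin := (chebyshevPolynomial_spec he (n * k)).2 ((Q.comp R).map (algebraMap ℝ ℂ))
    ((hQ.comp hR (by omega)).map _) (by rw [natDegree_map, natDegree_comp, hQk, hRn, mul_comm])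
  have : Nonempty e := hinf.nonempty.to_subtype
  refine hmin.trans (ciSup_le fun ⟨z, hz⟩ => ?_)
  obtain ⟨x, rfl⟩ : ∃ x : ℝ, (x : ℂ) = z := ⟨z.re, Complex.ext rfl (by simp [hreal z hz])⟩
  rw [norm_eval_map_ofReal, eval_comp]
  exact hQle _ ((hle x hz).trans_eq (by ring))

theorem theorem1p4 (e : Set ℂ) (he : IsCompact e) (hinf : e.Infinite)
    (hreal : ∀ z ∈ e, z.im = 0) (n : ℕ) (hn : 1 ≤ n)
    (h : chebyshevNorm he n = 2 * logCapacity e ^ n) :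
    ∀ k : ℕ, 1 ≤ k → chebyshevNorm he (n * k) = 2 * logCapacity e ^ (n * k) := by
  intro k hk
  refine le_antisymm ?_
    (two_mul_logCapacity_pow_le_chebyshevNorm he hinf hreal (Nat.mul_pos hn hk))
  refine (chebyshevNorm_mul_le he hinf hreal hn k).trans_eq ?_
  rw [h, mul_div_cancel_left₀ _ two_ne_zero, pow_mul]
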